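/- **Theorem 2.1.** Let $\Omega$ be a locally compact Hausdorff space equipped with a Borel probability measure $\mu$. Let $L_\infty(\Omega)$ be the space of all bounded measurable functions $f:\Omega\to\mathbb C$ (defined everywhere) with the norm $\|f\|_\infty=\sup_{x\in\Omega}|f(x)|$, and for $1\le q<\infty$ let $\|f\|_q=\bigl(\int_\Omega|f|^q\,d\mu\bigr)^{1/q}$. For a dictionary $\mathcal D_N=\{\varphi_1,\dots,\varphi_N\}\subset L_\infty(\Omega)$ and an integer $1\le v\le N$ put $$\Sigma_v(\mathcal D_N)=\bigcup_{J\subset\{1,\dots,N\},\,|J|=v}\operatorname{span}_{\mathbb C}\{\varphi_j: j\in J\},\qquad \Sigma_v^q(\mathcal D_N)=\{f\in\Sigma_v(\mathcal D_N):\|f\|_q\le1\}.$$ For a set $A\subset L_\infty(\Omega)$ and $t>0$ let $N_t(A,L_\infty)$ be the smallest $n$ for which there are $g_1,\dots,g_n\in A$ such that every $f\in A$ satisfies $\min_{j}\|f-g_j\|_\infty\le t$ (with $N_t(A,L_\infty)=\infty$ if there is no such $n$), and let $\varepsilon_k(A,L_\infty)=\inf\{t>0:\log_2N_t(A,L_\infty)\le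 k\}$. For every $1\le q<\infty$ there are constants $C(q)>1$ and $c_q>0$, depending only on $q$, with the following property. Let $\Omega$, $\mu$ be as above, let $1\le v\le N$ be integers, let $\mathcal D_N\subset L_\infty(\Omega)$ be a dictionary of $N$ functions, and let $B_1,B_2\ge1$ be constants such that $$\varepsilon_k(\Sigma_v^q(\mathcal D_N),L_\infty)\le B_1\,(v/k)^{1/q},\qquad k=1,2,\dots,$$ and $$\|f\|_\infty\le B_2\,v^{1/q}\,\|f\|_q\qquad\text{for all } f\in\Sigma_v(\mathcal D_N).$$ Let $\xi^1,\dots,\xi^m$ be independent random points of $\Omega$, not necessarily identically distributed, whose distributions $\mu_{\xi^k}$ satisfy $\frac1m\sum_{k=1}^m\mu_{\xi^k}=\mu$. If $$m\ge C(q)\,B_1^q\,v\,\bigl(\log(2B_2v)\bigr)^2,$$ then with probability at least $$1-\exp\Bigl[-\frac{c_q\,m}{B_2^q\,v\,\bigl(\log(2B_2v)\bigr)^2}\Bigr]$$ the inequalities $$\frac34\|f\|_q^q\le\frac1m\sum_{j=1}^m|f(\xi^j)|^q\le\frac54\|f\|_q^q$$ hold simultaneously for all $f\in\Sigma_v(\mathcal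 D_N)$. -/

import Mathlib

open MeasureTheory ProbabilityTheory
open scoped NNReal ENNReal

namespace SparseDiscretization

noncomputable section

/-- The Banach space `L_∞(Ω)` of all bounded measurable functions `Ω → ℂ` (everywhere defined
functions, not classes), as a subspace of the space of all bounded functions with its
supremum norm. -/
def LInf (Ω : Type*) [MeasurableSpace Ω] : Submodule ℂ (lp (fun _ : Ω => ℂ) ∞) where
  carrier := {f | Measurable (f : Ω → ℂ)}
  zero_mem' := by
    simp only [Set.mem_ofPred_eq, lp.coeFn_zero]
    exact measurable_const
  add_mem' := by
    intro f g hf hg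
    simp only [Set.mem_ofPred_eq, lp.coeFn_add] at *
    exact hf.add hg
  smul_mem' := by
    intro c f hf
    simp only [Set.mem_ofPred_eq, lp.coeFn_smul] at *
    exact hf.const_smul c

instance (Ω : Type*) [MeasurableSpace Ω] : CoeFun (LInf Ω) (fun _ => Ω → ℂ) :=
  ⟨fun f => (f.1 : Ω → ℂ)⟩

/-- The norm of `LInf Ω` is `‖f‖_∞ = sup_{x ∈ Ω} |f x|`. -/
theorem LInf.norm_eq_iSup {Ω : Type*} [MeasurableSpace Ω] (f : LInf Ω) :
    ‖f‖ = ⨆ x, ‖f x‖ :=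
  lp.norm_eq_ciSup f.1

/-- `‖f‖_q = (∫ |f|^q dμ)^{1/q}`, used for `1 ≤ q < ∞`. -/
def lqNorm {Ω : Type*} [MeasurableSpace Ω] (μ : Measure Ω) (q : ℝ) (f : LInf Ω) : ℝ :=
  (∫ x, ‖f x‖ ^ q ∂μ) ^ (1 / q)

/-- `Σ_v(D_N)`: the functions which are `v`-sparse with respect to the dictionary
`φ_1, …, φ_N`, i.e. the union of the spans of `{φ_j : j ∈ J}` over all `J` with `|J| = v`. -/
def sparseSet {Ω : Type*} [MeasurableSpace Ω] {N : ℕ} (φ : Fin N → LInf Ω) (v : ℕ) :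
    Set (LInf Ω) :=
  {f | ∃ J : Finset (Fin N), J.card = v ∧ f ∈ Submodule.span ℂ (φ '' (J : Set (Fin N)))}

/-- `Σ_v^q(D_N) = {f ∈ Σ_v(D_N) : ‖f‖_q ≤ 1}`. -/
def sparseBall {Ω : Type*} [MeasurableSpace Ω] (μ : Measure Ω) (q : ℝ) {N : ℕ}
    (φ : Fin N → LInf Ω) (v : ℕ) : Set (LInf Ω) :=
  {f | f ∈ sparseSet φ v ∧ lqNorm μ q f ≤ 1}

/-- The entropy numbers `ε_k(A, X) = inf {t > 0 : log₂ N_t(A, X) ≤ k}`, where `N_t(A, X)` is the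
least number of closed balls of radius `t` with centres in `A` that cover `A`. The values are
extended nonnegative reals (the infimum of the empty set is `∞`), and `log₂ N ≤ k` is written
`N ≤ 2 ^ k`. -/
def entropyNumber {X : Type*} [PseudoEMetricSpace X] (k : ℕ) (A : Set X) : ℝ≥0∞ :=
  ⨅ (t : ℝ≥0) (_ : 0 < t) (_ : Metric.coveringNumber t A ≤ 2 ^ k), (t : ℝ≥0∞)

end

end SparseDiscretization

namespace SparseDiscretization

/-! ### Decomposition of `s ^ q` into dyadic layers -/

/-! By homogeneity it suffices to treat sparse `f` with `‖f‖_q = 1`. Telescoping at the heights `a_j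
= 2 ^ j / 32` writes `|f|^q` as a part of size at most `1/32` plus the layers `layer q a_j |f|`. In
layer `j`, replace `f` by a nearest point `g_j` of a net of the sparse ball with sup-norm radius `δ
a_j`, `δ = netRatio q`. The error in a layer is at most `q δ (2 a_j)^q`, and it occurs only where
`|f| ≥ a_j / 2`, so the errors sum geometrically to at most `|f|^q / 32`, with no loss in the number
of layers (`abs_rpow_sub_sum_layer_le`).

It remains to discretize the layers of the net functions to precision `ε`. A layer is bounded by `(2
a_j)^q` and has mean at most `1`, so Bernstein's inequality gives failure probability at most `2
exp(-m ε² / (4 (2 a_j)^q))`. With `B = B₁ v^(1/q)`, the entropy hypothesis bounds the logarithm of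
the size of the net by a multiple of `(B / (δ a_j))^q`. Both exponents scale like `a_j^(-q)`, so the
single condition `m ε² ≳ B^q = B₁^q v` makes the union bound work at every level
(`sum_two_pow_netExponent_mul_exp_le`).

The heights stop at the sup-norm bound `H` of the sparse ball, so there are `O(log(2 B₂ v))` of
them. The deviations add up over the levels, which forces `ε ≍ 1 / log(2 B₂ v)` and produces the
squared logarithm. -/

theorem rpow_sub_rpow_le_mul {q x y : ℝ} (hq : 1 ≤ q) (hy : 0 ≤ y) (hyx : y ≤ x) :
    x ^ q - y ^ q ≤ q * x ^ (q - 1) * (x - y) := by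
  rcases eq_or_lt_of_le (hy.trans hyx) with hx | hx
  · have : y = 0 := le_antisymm (hx ▸ hyx) hy
    simp [← hx, this]
  -- Bernoulli's inequality at `y / x - 1`, to be multiplied by `x ^ q`.
  have h := one_add_mul_self_le_rpow_one_add (s := y / x - 1) (p := q)
    (by have : 0 ≤ y / x := by positivity
        linarith) hq
  rw [add_sub_cancel, Real.div_rpow hy hx.le, le_div_iff₀ (by positivity)] at h
  have hxq : x ^ q = x ^ (q - 1) * x := by
    rw [← Real.rpow_add_one hx.ne', sub_add_cancel]
  have : (1 + q * (y / x - 1)) * x ^ q = x ^ q - q * x ^ (q - 1) * (x - y) := by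
    rw [hxq]
    field_simp
    ring
  linarith

/-- The increment of `t ↦ t ^ q` from `min s a` to `min s (2 * a)`. -/
noncomputable def layer (q a s : ℝ) : ℝ := (min s (2 * a)) ^ q - (min s a) ^ q

theorem measurable_layer (q a : ℝ) : Measurable (layer q a) := by
  unfold layer
  fun_prop

theorem layer_nonneg {q a s : ℝ} (hq : 1 ≤ q) (ha : 0 < a) (hs : 0 ≤ s) : 0 ≤ layer q a s :=
  sub_nonneg.2 <| Real.rpow_le_rpow (le_min hs ha.le) (min_le_min_left _ (by linarith))
    (by linarith)

theorem layer_le_rpow {q a s : ℝ} (hq : 1 ≤ q) (ha : 0 < a) (hs : 0 ≤ s) :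
    layer q a s ≤ s ^ q := by
  have h1 : (min s (2 * a)) ^ q ≤ s ^ q :=
    Real.rpow_le_rpow (le_min hs (by linarith)) (min_le_left _ _) (by linarith)
  have h2 : 0 ≤ (min s a) ^ q := Real.rpow_nonneg (le_min hs ha.le) _
  unfold layer
  linarith

theorem layer_le {q a s : ℝ} (hq : 1 ≤ q) (ha : 0 < a) (hs : 0 ≤ s) :
    layer q a s ≤ (2 * a) ^ q := by
  have h1 : (min s (2 * a)) ^ q ≤ (2 * a) ^ q :=
    Real.rpow_le_rpow (le_min hs (by linarith)) (min_le_right _ _) (by linarith)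
  have h2 : 0 ≤ (min s a) ^ q := Real.rpow_nonneg (le_min hs ha.le) _
  unfold layer
  linarith

theorem layer_eq_zero {q a s : ℝ} (ha : 0 < a) (hs : s ≤ a) : layer q a s = 0 := by
  unfold layer
  rw [min_eq_left hs, min_eq_left (by linarith), sub_self]

theorem min_rpow_sub_min_rpow_le {q b s s' d : ℝ} (hq : 1 ≤ q) (hb : 0 < b) (hs' : 0 ≤ s')
    (hss : s' ≤ s) (hd : s - s' ≤ d) :
    (min s b) ^ q - (min s' b) ^ q ≤ q * b ^ (q - 1) * d := by
  have h0 : 0 ≤ min s' b := le_min hs' hb.le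
  have h1 : min s' b ≤ min s b := min_le_min_right _ hss
  have h2 : min s b - min s' b ≤ d := by
    have : min s b ≤ min s' b + (s - s') := by
      rcases le_total s' b with h | h
      · rw [min_eq_left h]
        linarith [min_le_left s b]
      · rw [min_eq_right h]
        linarith [min_le_right s b]
    linarith
  have h3 : (min s b) ^ (q - 1) ≤ b ^ (q - 1) :=
    Real.rpow_le_rpow (h0.trans h1) (min_le_right _ _) (by linarith)
  have hbq : 0 ≤ b ^ (q - 1) := by positivity
  calc _ ≤ q * (min s b) ^ (q - 1) * (min s b - min s' b) := rpow_sub_rpow_le_mul hq h0 h1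
    _ ≤ q * b ^ (q - 1) * d := by
      have : 0 ≤ min s b - min s' b := by linarith
      gcongr

/-- A layer is a difference of two truncated powers, both nondecreasing in `s`. Its variation is
therefore at most the larger of their two increments. -/
theorem abs_layer_sub_layer_le_of_le {q a s s' δ : ℝ} (hq : 1 ≤ q) (ha : 0 < a) (hδ : 0 ≤ δ)
    (hs' : 0 ≤ s') (hss : s' ≤ s) (hd : s - s' ≤ δ * a) :
    |layer q a s - layer q a s'| ≤ q * δ * (2 * a) ^ q := by
  have ha2 : (2 * a) ^ q = (2 * a) ^ (q - 1) * (2 * a) := by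
    rw [← Real.rpow_add_one (by positivity), sub_add_cancel]
  have hp : 0 ≤ (2 * a) ^ (q - 1) := by positivity
  have hmono : a ^ (q - 1) ≤ (2 * a) ^ (q - 1) :=
    Real.rpow_le_rpow ha.le (by linarith) (by linarith)
  have h1 := min_rpow_sub_min_rpow_le hq (b := 2 * a) (by linarith) hs' hss hd
  have h2 := min_rpow_sub_min_rpow_le hq ha hs' hss hd
  have h3 : (min s' (2 * a)) ^ q ≤ (min s (2 * a)) ^ q :=
    Real.rpow_le_rpow (le_min hs' (by linarith)) (min_le_min_right _ hss) (by linarith)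
  have h4 : (min s' a) ^ q ≤ (min s a) ^ q :=
    Real.rpow_le_rpow (le_min hs' ha.le) (min_le_min_right _ hss) (by linarith)
  have h5 : q * (2 * a) ^ (q - 1) * (δ * a) ≤ q * δ * (2 * a) ^ q := by
    rw [ha2]
    have : 0 ≤ q * (2 * a) ^ (q - 1) * (δ * a) := by positivity
    linarith
  have h6 : q * a ^ (q - 1) * (δ * a) ≤ q * (2 * a) ^ (q - 1) * (δ * a) := by gcongr
  unfold layer
  rw [abs_le]
  constructor <;> linarith

/-- If `s < a / 2`, then `s'` is still below `a` and both layers vanish. This localization is what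
makes the errors summable over the levels. -/
theorem abs_layer_sub_layer_le {q a s s' δ : ℝ} (hq : 1 ≤ q) (ha : 0 < a) (hδ : 0 ≤ δ)
    (hδ1 : δ ≤ 1 / 2) (hs : 0 ≤ s) (hs' : 0 ≤ s') (hd : |s - s'| ≤ δ * a) :
    |layer q a s - layer q a s'| ≤ q * δ * if a ≤ 2 * s then (2 * a) ^ q else 0 := by
  split_ifs with h
  · rcases le_total s' s with hss | hss
    · exact abs_layer_sub_layer_le_of_le hq ha hδ hs' hss ((le_abs_self _).trans hd)
    · rw [abs_sub_comm]
      refine abs_layer_sub_layer_le_of_le hq ha hδ hs hss ?_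
      rw [abs_sub_comm] at hd
      exact (le_abs_self _).trans hd
  · have h1 := (abs_le.1 hd).1
    have h2 : δ * a ≤ 1 / 2 * a := by gcongr
    rw [layer_eq_zero ha (by linarith), layer_eq_zero ha (by linarith)]
    simp

/-- The terms at least double because `q ≥ 1`, so the last nonzero one dominates. The cap `τ * 2 ^
J` in the bound is there to carry the induction. -/
theorem sum_dyadic_rpow_le {q τ s : ℝ} (hq : 1 ≤ q) (hτ : 0 < τ) (hs : 0 ≤ s) (J : ℕ) :
    (∑ j ∈ Finset.range J, if τ * 2 ^ j ≤ 2 * s then (2 * (τ * 2 ^ j)) ^ q else 0) ≤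
      2 * (min (4 * s) (τ * 2 ^ J)) ^ q := by
  induction J with
  | zero => simp only [Finset.range_zero, Finset.sum_empty]; positivity
  | succ J ih =>
    rw [Finset.sum_range_succ]
    have ha : 0 < τ * 2 ^ J := by positivity
    have hsucc : τ * 2 ^ (J + 1) = 2 * (τ * 2 ^ J) := by ring
    split_ifs with h
    · have h1 : (min (4 * s) (τ * 2 ^ J)) ^ q ≤ (τ * 2 ^ J) ^ q :=
        Real.rpow_le_rpow (by positivity) (min_le_right _ _) (by linarith)
      have h2 : 2 * (τ * 2 ^ J) ^ q ≤ (2 * (τ * 2 ^ J)) ^ q := by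
        rw [Real.mul_rpow (by norm_num) ha.le]
        have : (2 : ℝ) ≤ 2 ^ q := by
          simpa using Real.rpow_le_rpow_of_exponent_le (by norm_num : (1 : ℝ) ≤ 2) hq
        gcongr
      rw [hsucc, min_eq_right (by linarith)]
      linarith
    · have : (min (4 * s) (τ * 2 ^ J)) ^ q ≤ (min (4 * s) (τ * 2 ^ (J + 1))) ^ q :=
        Real.rpow_le_rpow (by positivity) (min_le_min_left _ (by linarith)) (by linarith)
      linarith

/-- The relative radius of the nets used for the dyadic layers. -/
noncomputable def netRatio (q : ℝ) : ℝ := 1 / (64 * q * 4 ^ q)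

theorem netRatio_pos {q : ℝ} (hq : 1 ≤ q) : 0 < netRatio q := by
  unfold netRatio; positivity

theorem netRatio_le {q : ℝ} (hq : 1 ≤ q) : netRatio q ≤ 1 / 64 := by
  unfold netRatio
  have : (1 : ℝ) ≤ 4 ^ q := Real.one_le_rpow (by norm_num) (by linarith)
  apply one_div_le_one_div_of_le (by norm_num)
  nlinarith

theorem abs_rpow_sub_sum_layer_le {q s : ℝ} (hq : 1 ≤ q) (hs : 0 ≤ s) {J : ℕ}
    (hsJ : s ≤ 1 / 32 * 2 ^ J) (r : ℕ → ℝ) (hr : ∀ j, 0 ≤ r j)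
    (hsr : ∀ j < J, |s - r j| ≤ netRatio q * (1 / 32 * 2 ^ j)) :
    |s ^ q - ∑ j ∈ Finset.range J, layer q (1 / 32 * 2 ^ j) (r j)| ≤ 1 / 32 + 1 / 32 * s ^ q := by
  set a : ℕ → ℝ := fun j => 1 / 32 * 2 ^ j with ha
  have hapos : ∀ j, 0 < a j := fun j => by simp only [ha]; positivity
  have htel : ∑ j ∈ Finset.range J, layer q (a j) s = s ^ q - (min s (1 / 32)) ^ q := by
    have h1 : ∀ j, layer q (a j) s = (min s (a (j + 1))) ^ q - (min s (a j)) ^ q := fun j => by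
      rw [layer, show 2 * a j = a (j + 1) by simp only [ha]; ring]
    simp_rw [h1]
    rw [Finset.sum_range_sub (fun j => (min s (a j)) ^ q) J, min_eq_left hsJ]
    simp [ha]
  have hlow : (min s (1 / 32)) ^ q ≤ 1 / 32 := by
    have h1 : (min s (1 / 32)) ^ q ≤ (1 / 32 : ℝ) ^ q :=
      Real.rpow_le_rpow (by positivity) (min_le_right _ _) (by linarith)
    have h2 : (1 / 32 : ℝ) ^ q ≤ (1 / 32 : ℝ) ^ (1 : ℝ) :=
      Real.rpow_le_rpow_of_exponent_ge (by norm_num) (by norm_num) hq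
    simpa using h1.trans h2
  have hlow0 : 0 ≤ (min s (1 / 32)) ^ q := by positivity
  have hδ := netRatio_pos hq
  have hdiff : |∑ j ∈ Finset.range J, layer q (a j) s -
      ∑ j ∈ Finset.range J, layer q (a j) (r j)| ≤ 1 / 32 * s ^ q := by
    rw [← Finset.sum_sub_distrib]
    calc _ ≤ ∑ j ∈ Finset.range J, |layer q (a j) s - layer q (a j) (r j)| :=
          Finset.abs_sum_le_sum_abs _ _
      _ ≤ ∑ j ∈ Finset.range J, q * netRatio q *
            (if a j ≤ 2 * s then (2 * a j) ^ q else 0) :=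
          Finset.sum_le_sum fun j hj => abs_layer_sub_layer_le hq (hapos j) hδ.le
            ((netRatio_le hq).trans (by norm_num)) hs (hr j) (hsr j (Finset.mem_range.1 hj))
      _ ≤ q * netRatio q * (2 * (min (4 * s) (1 / 32 * 2 ^ J)) ^ q) := by
          rw [← Finset.mul_sum]
          gcongr
          exact sum_dyadic_rpow_le hq (by norm_num) hs J
      _ ≤ q * netRatio q * (2 * (4 * s) ^ q) := by
          gcongr
          exact min_le_left _ _
      -- The value of `netRatio` is chosen for this: `q * netRatio q * 2 * 4 ^ q = 1 / 32`.
      _ = 1 / 32 * s ^ q := by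
          rw [netRatio, Real.mul_rpow (by norm_num) hs]
          field_simp
          ring
  rw [abs_le] at hdiff ⊢
  constructor <;> linarith [hdiff.1, hdiff.2]

/-! ### A Bernstein type inequality -/

/-- Uses `exp x ≤ 1 + x + x ^ 2` for `|x| ≤ 1` and `Y ^ 2 ≤ M * Y`: for a nonnegative bounded
variable the mean controls the second moment. -/
theorem mgf_le_exp_of_mem_Icc {S : Type*} [MeasurableSpace S] {P : Measure S}
    [IsProbabilityMeasure P] {Y : S → ℝ} (hY : Measurable Y) {M t : ℝ} (h0 : ∀ s, 0 ≤ Y s)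
    (hM : ∀ s, Y s ≤ M) (ht : |t| * M ≤ 1) :
    mgf Y P t ≤ Real.exp ((t + t ^ 2 * M) * ∫ s, Y s ∂P) := by
  have hb : ∀ s, ‖Y s‖ ≤ M := fun s => by rw [Real.norm_of_nonneg (h0 s)]; exact hM s
  have hint : Integrable Y P := Integrable.of_bound hY.aestronglyMeasurable M (.of_forall hb)
  calc mgf Y P t ≤ ∫ s, (1 + (t + t ^ 2 * M) * Y s) ∂P := by
        refine integral_mono_of_nonneg (.of_forall fun s => (Real.exp_pos _).le)
          ((integrable_const _).add (hint.const_mul _)) (.of_forall fun s => ?_)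
        have h1 : |t * Y s| ≤ 1 := by
          rw [abs_mul, abs_of_nonneg (h0 s)]
          exact (mul_le_mul_of_nonneg_left (hM s) (abs_nonneg _)).trans ht
        have h2 := (abs_le.1 (Real.abs_exp_sub_one_sub_id_le h1)).2
        have h3 : (t * Y s) ^ 2 ≤ t ^ 2 * M * Y s := by
          have := mul_le_mul_of_nonneg_right (hM s) (h0 s)
          nlinarith [sq_nonneg t]
        simp only
        linarith
    _ = 1 + (t + t ^ 2 * M) * ∫ s, Y s ∂P := by
        rw [integral_add (integrable_const _) (hint.const_mul _), integral_const_mul]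
        simp
    _ ≤ _ := by
        rw [add_comm]
        exact Real.add_one_le_exp _

/-- Chernoff's method on both tails. Only the sum of the means enters, so the variables need not be
identically distributed; `p ≤ 1` keeps `M` to the first power in the exponent. -/
theorem measureReal_abs_average_sub_ge_le {S : Type*} [MeasurableSpace S] {P : Measure S}
    [IsProbabilityMeasure P] {m : ℕ} (hm : 0 < m) {Y : Fin m → S → ℝ}
    (hY : ∀ j, Measurable (Y j)) (hind : iIndepFun Y P) {M p ε : ℝ} (hMpos : 0 < M)
    (h0 : ∀ j s, 0 ≤ Y j s) (hM : ∀ j s, Y j s ≤ M)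
    (hp : 1 / (m : ℝ) * ∑ j, ∫ s, Y j s ∂P = p) (hp1 : p ≤ 1) (hε : 0 < ε) (hε1 : ε ≤ 1) :
    P.real {s | ε ≤ |1 / (m : ℝ) * ∑ j, Y j s - p|} ≤
      2 * Real.exp (-(m * ε ^ 2 / (4 * M))) := by
  have hm' : (0 : ℝ) < m := by exact_mod_cast hm
  have hsum : ∑ j, ∫ s, Y j s ∂P = m * p := by rw [← hp]; field_simp
  have hmgf : ∀ t : ℝ, |t| * M ≤ 1 →
      mgf (∑ j, Y j) P t ≤ Real.exp ((t + t ^ 2 * M) * (m * p)) := fun t ht => by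
    rw [hind.mgf_sum hY, ← hsum, Finset.mul_sum, Real.exp_sum]
    exact Finset.prod_le_prod (fun j _ => mgf_nonneg)
      fun j _ => mgf_le_exp_of_mem_Icc (hY j) (h0 j) (hM j) ht
  have hint : ∀ t : ℝ, Integrable (fun s => Real.exp (t * (∑ j, Y j) s)) P := fun t => by
    refine Integrable.of_bound (by fun_prop) (Real.exp (|t| * (m * M))) (.of_forall fun s => ?_)
    rw [Real.norm_of_nonneg (Real.exp_pos _).le, Real.exp_le_exp]
    have h1 : 0 ≤ (∑ j, Y j) s := by
      rw [Finset.sum_apply]; exact Finset.sum_nonneg fun j _ => h0 j s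
    have h2 : (∑ j, Y j) s ≤ m * M := by
      rw [Finset.sum_apply]
      refine (Finset.sum_le_sum fun j _ => hM j s).trans ?_
      simp
    calc t * (∑ j, Y j) s ≤ |t| * (∑ j, Y j) s := by gcongr; exact le_abs_self t
      _ ≤ _ := by gcongr
  -- With this `t`, the quadratic term `t ^ 2 * M * p` costs at most half of the linear gain `t *
  -- ε`.
  set t : ℝ := ε / (2 * M) with ht_def
  have htpos : 0 < t := by positivity
  have htM : t * M = ε / 2 := by rw [ht_def]; field_simp
  have key : m * ε ^ 2 / (4 * M) = m * (t * (ε / 2)) := by rw [ht_def]; field_simp; norm_num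
  have hup := measure_ge_le_exp_mul_mgf (μ := P) (X := ∑ j, Y j) (m * (p + ε)) htpos.le (hint t)
  have hlo := measure_le_le_exp_mul_mgf (μ := P) (X := ∑ j, Y j) (m * (p - ε))
    (neg_nonpos.2 htpos.le) (hint (-t))
  have hexp : ∀ x y : ℝ, x + y ≤ -(m * ε ^ 2 / (4 * M)) → ∀ z, z ≤ Real.exp y →
      Real.exp x * z ≤ Real.exp (-(m * ε ^ 2 / (4 * M))) := fun x y hxy z hz => by
    calc Real.exp x * z ≤ Real.exp x * Real.exp y := by gcongr
      _ = Real.exp (x + y) := (Real.exp_add _ _).symm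
      _ ≤ _ := Real.exp_le_exp.2 hxy
  have hquad : m * (t * (ε / 2)) * p ≤ m * (t * (ε / 2)) := by
    have : 0 ≤ m * (t * (ε / 2)) := by positivity
    nlinarith
  have hup' := hup.trans (hexp _ _ (by
    rw [key, show t ^ 2 * M = t * (ε / 2) by rw [pow_two, mul_assoc, htM]]
    nlinarith) _ (hmgf t (by rw [abs_of_pos htpos, htM]; linarith)))
  have hlo' := hlo.trans (hexp _ _ (by
    rw [key, neg_sq, show t ^ 2 * M = t * (ε / 2) by rw [pow_two, mul_assoc, htM]]
    nlinarith) _ (hmgf (-t) (by rw [abs_neg, abs_of_pos htpos, htM]; linarith)))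
  have hsub : {s | ε ≤ |1 / (m : ℝ) * ∑ j, Y j s - p|} ⊆
      {s | m * (p + ε) ≤ (∑ j, Y j) s} ∪ {s | (∑ j, Y j) s ≤ m * (p - ε)} := by
    intro s hs
    have hdiv : 1 / (m : ℝ) * ∑ j, Y j s = (∑ j, Y j s) / m := by ring
    rw [Set.mem_ofPred_eq, hdiv] at hs
    simp only [Set.mem_union, Set.mem_ofPred_eq, Finset.sum_apply]
    rcases le_abs.1 hs with h | h
    · left
      have : p + ε ≤ (∑ j, Y j s) / m := by linarith
      rw [le_div_iff₀ hm'] at this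
      linarith
    · right
      have : (∑ j, Y j s) / m ≤ p - ε := by linarith
      rw [div_le_iff₀ hm'] at this
      linarith
  calc _ ≤ _ := measureReal_mono hsub
    _ ≤ _ := measureReal_union_le _ _
    _ ≤ _ := by linarith

/-! ### Nets and the spaces `LInf Ω` -/

theorem exists_finset_net_of_entropyNumber_lt {X : Type*} [PseudoMetricSpace X] {k : ℕ}
    {A : Set X} {r : ℝ} (h : entropyNumber k A < ENNReal.ofReal r) :
    ∃ T : Finset X, (T : Set X) ⊆ A ∧ T.card ≤ 2 ^ k ∧ ∀ f ∈ A, ∃ g ∈ T, dist f g ≤ r := by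
  unfold entropyNumber at h
  simp only [iInf_lt_iff] at h
  obtain ⟨t, -, hcov, htr⟩ := h
  have htop : Metric.coveringNumber t A ≠ ⊤ := by
    refine ne_top_of_le_ne_top ?_ hcov
    exact_mod_cast ENat.natCast_ne_top (2 ^ k)
  have hfin := Metric.finite_minimalCover (ε := t) (A := A)
  refine ⟨hfin.toFinset, by simpa using Metric.minimalCover_subset, ?_, fun f hf => ?_⟩
  · have h1 := Metric.encard_minimalCover htop
    rw [hfin.encard_eq_coe_toFinset_card] at h1
    rw [← h1] at hcov
    exact_mod_cast hcov
  · obtain ⟨g, hg, hfg⟩ := Metric.isCover_minimalCover htop hf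
    refine ⟨g, by simpa using hg, ?_⟩
    have h1 : edist f g < ENNReal.ofReal r := lt_of_le_of_lt hfg htr
    rw [edist_dist] at h1
    exact (ENNReal.ofReal_lt_ofReal_iff'.1 h1).1.le

section

variable {Ω : Type*} [MeasurableSpace Ω]

theorem LInf.measurable (f : LInf Ω) : Measurable (f : Ω → ℂ) := f.2

theorem LInf.norm_apply_le (f : LInf Ω) (x : Ω) : ‖f x‖ ≤ ‖f‖ :=
  lp.norm_apply_le_norm ENNReal.top_ne_zero f.1 x

theorem LInf.abs_norm_sub_norm_le (f g : LInf Ω) (x : Ω) : |‖f x‖ - ‖g x‖| ≤ dist f g := by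
  rw [dist_eq_norm]
  exact (_root_.abs_norm_sub_norm_le _ _).trans (LInf.norm_apply_le (f - g) x)

theorem LInf.integrable_rpow (μ : Measure Ω) [IsFiniteMeasure μ] {q : ℝ} (hq : 0 ≤ q)
    (f : LInf Ω) : Integrable (fun x => ‖f x‖ ^ q) μ := by
  refine Integrable.of_bound ((LInf.measurable f).norm.pow_const q).aestronglyMeasurable (‖f‖ ^ q)
    (.of_forall fun x => ?_)
  rw [Real.norm_of_nonneg (by positivity)]
  exact Real.rpow_le_rpow (norm_nonneg _) (LInf.norm_apply_le f x) hq

theorem LInf.integrable_layer (μ : Measure Ω) [IsFiniteMeasure μ] {q a : ℝ} (hq : 1 ≤ q)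
    (ha : 0 < a) (f : LInf Ω) : Integrable (fun x => layer q a ‖f x‖) μ := by
  refine Integrable.of_bound ((measurable_layer q a).comp (LInf.measurable f).norm).aestronglyMeasurable
    ((2 * a) ^ q) (.of_forall fun x => ?_)
  rw [Real.norm_of_nonneg (layer_nonneg hq ha (norm_nonneg _))]
  exact layer_le hq ha (norm_nonneg _)

theorem lqNorm_nonneg (μ : Measure Ω) (q : ℝ) (f : LInf Ω) : 0 ≤ lqNorm μ q f :=
  Real.rpow_nonneg (integral_nonneg fun _ => by positivity) _

theorem lqNorm_rpow (μ : Measure Ω) {q : ℝ} (hq : 1 ≤ q) (f : LInf Ω) :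
    lqNorm μ q f ^ q = ∫ x, ‖f x‖ ^ q ∂μ := by
  rw [lqNorm, ← Real.rpow_mul (integral_nonneg fun _ => by positivity),
    one_div_mul_cancel (by linarith), Real.rpow_one]

theorem LInf.norm_smul_apply (c : ℂ) (f : LInf Ω) (x : Ω) : ‖(c • f) x‖ = ‖c‖ * ‖f x‖ := by
  have : (c • f) x = c * f x := rfl
  rw [this, norm_mul]

theorem lqNorm_smul (μ : Measure Ω) {q : ℝ} (hq : 1 ≤ q) (c : ℂ) (f : LInf Ω) :
    lqNorm μ q (c • f) = ‖c‖ * lqNorm μ q f := by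
  unfold lqNorm
  simp_rw [LInf.norm_smul_apply, Real.mul_rpow (norm_nonneg c) (norm_nonneg _)]
  rw [integral_const_mul, Real.mul_rpow (by positivity)
    (integral_nonneg fun _ => by positivity), ← Real.rpow_mul (norm_nonneg c),
    mul_one_div_cancel (by linarith), Real.rpow_one]

variable {N : ℕ} {φ : Fin N → LInf Ω} {v : ℕ}

theorem smul_mem_sparseSet {f : LInf Ω} (hf : f ∈ sparseSet φ v) (c : ℂ) :
    c • f ∈ sparseSet φ v := by
  obtain ⟨J, hJ, hfJ⟩ := hf
  exact ⟨J, hJ, Submodule.smul_mem _ _ hfJ⟩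

theorem smul_mem_sparseBall {μ : Measure Ω} {q : ℝ} (hq : 1 ≤ q) {f : LInf Ω}
    (hf : f ∈ sparseBall μ q φ v) {c : ℂ} (hc : ‖c‖ ≤ 1) : c • f ∈ sparseBall μ q φ v := by
  refine ⟨smul_mem_sparseSet hf.1 c, ?_⟩
  rw [lqNorm_smul μ hq]
  exact mul_le_one₀ hc (lqNorm_nonneg _ _ _) hf.2

/-- Two of the three points `f`, `0`, `-f` lie in one of the two balls. -/
theorem norm_le_of_entropyNumber_one_lt {μ : Measure Ω} {q : ℝ} (hq : 1 ≤ q) {r : ℝ}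
    (h : entropyNumber 1 (sparseBall μ q φ v) < ENNReal.ofReal r) {f : LInf Ω}
    (hf : f ∈ sparseBall μ q φ v) : ‖f‖ ≤ 2 * r := by
  obtain ⟨T, -, hcard, hT⟩ := exists_finset_net_of_entropyNumber_lt h
  have hmem : ∀ c : ({0, 1, -1} : Finset ℂ), ∃ g ∈ T, dist ((c : ℂ) • f) g ≤ r := fun c =>
    hT _ (smul_mem_sparseBall hq hf (by
      have := c.2
      simp only [Finset.mem_insert, Finset.mem_singleton] at this
      rcases this with h | h | h <;> rw [h] <;> simp))
  choose g hgT hg using hmem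
  have h3 : ({0, 1, -1} : Finset ℂ).card = 3 := by
    rw [Finset.card_eq_three]
    exact ⟨0, 1, -1, by norm_num, by norm_num, by norm_num, rfl⟩
  obtain ⟨c, -, c', -, hne, heq⟩ := Finset.exists_ne_map_eq_of_card_lt_of_maps_to
    (s := (Finset.univ : Finset ({0, 1, -1} : Finset ℂ))) (t := T) (f := g)
    (by rw [Finset.card_univ, Fintype.card_coe, h3]; omega) (fun c _ => hgT c)
  have h1 : dist ((c : ℂ) • f) ((c' : ℂ) • f) ≤ 2 * r := by
    have := dist_triangle_right ((c : ℂ) • f) ((c' : ℂ) • f) (g c)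
    have h' := hg c'
    rw [← heq] at h'
    linarith [hg c]
  rw [dist_eq_norm, ← sub_smul, norm_smul] at h1
  have h2 : 1 ≤ ‖(c : ℂ) - c'‖ := by
    obtain ⟨c, hc⟩ := c
    obtain ⟨c', hc'⟩ := c'
    have hne' : c ≠ c' := fun h => hne (Subtype.ext h)
    simp only [Finset.mem_insert, Finset.mem_singleton] at hc hc'
    rcases hc with rfl | rfl | rfl <;> rcases hc' with rfl | rfl | rfl <;>
      first
        | exact absurd rfl hne'
        | norm_num
  nlinarith [norm_nonneg f]

/-! ### Averages of measures -/

theorem integral_average {m : ℕ} (ν : Fin m → Measure Ω) {F : Ω → ℝ}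
    (hF : ∀ j, Integrable F (ν j)) :
    ∫ x, F x ∂((m : ℝ≥0∞)⁻¹ • ∑ j, ν j) = 1 / (m : ℝ) * ∑ j, ∫ x, F x ∂(ν j) := by
  rw [integral_smul_measure, integral_finsetSum_measure fun j _ => hF j]
  simp

theorem isProbabilityMeasure_average {m : ℕ} (hm : 0 < m) (ν : Fin m → Measure Ω)
    [∀ j, IsProbabilityMeasure (ν j)] :
    IsProbabilityMeasure ((m : ℝ≥0∞)⁻¹ • ∑ j, ν j) := by
  constructor
  simp only [Measure.smul_apply, Measure.finsetSum_apply, measure_univ, Finset.sum_const,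
    Finset.card_univ, Fintype.card_fin, smul_eq_mul, nsmul_eq_mul, mul_one]
  exact ENNReal.inv_mul_cancel (by exact_mod_cast hm.ne') (ENNReal.natCast_ne_top m)

theorem integral_average_dirac {m : ℕ} (x : Fin m → Ω) {F : Ω → ℝ} (hF : Measurable F) :
    ∫ y, F y ∂((m : ℝ≥0∞)⁻¹ • ∑ j, Measure.dirac (x j)) = 1 / (m : ℝ) * ∑ j, F (x j) := by
  rw [integral_average _ fun j => ?_]
  · simp_rw [integral_dirac' F _ hF.stronglyMeasurable]
  · exact integrable_dirac' hF.stronglyMeasurable enorm_lt_top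

/-- Stated for an arbitrary probability measure because it is needed both for `μ` and for the
empirical measure, the average of Dirac masses at the sample. -/
theorem abs_integral_rpow_sub_sum_layer_le (ν : Measure Ω) [IsProbabilityMeasure ν] {q : ℝ}
    (hq : 1 ≤ q) {J : ℕ} {f : LInf Ω} (hf : ‖f‖ ≤ 1 / 32 * 2 ^ J) (g : ℕ → LInf Ω)
    (hg : ∀ j < J, dist f (g j) ≤ netRatio q * (1 / 32 * 2 ^ j)) :
    |∫ x, ‖f x‖ ^ q ∂ν - ∑ j ∈ Finset.range J, ∫ x, layer q (1 / 32 * 2 ^ j) ‖g j x‖ ∂ν| ≤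
      1 / 32 + 1 / 32 * ∫ x, ‖f x‖ ^ q ∂ν := by
  have hi1 := LInf.integrable_rpow ν (by linarith : 0 ≤ q) f
  have hi2 : ∀ j ∈ Finset.range J, Integrable (fun x => layer q (1 / 32 * 2 ^ j) ‖g j x‖) ν :=
    fun j _ => LInf.integrable_layer ν hq (by positivity) (g j)
  rw [← integral_finsetSum _ hi2, ← integral_sub hi1 (integrable_finsetSum _ hi2)]
  calc _ ≤ ∫ x, |‖f x‖ ^ q - ∑ j ∈ Finset.range J, layer q (1 / 32 * 2 ^ j) ‖g j x‖| ∂ν :=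
        abs_integral_le_integral_abs
    _ ≤ ∫ x, (1 / 32 + 1 / 32 * ‖f x‖ ^ q) ∂ν := by
        refine integral_mono (hi1.sub (integrable_finsetSum _ hi2)).abs
          ((integrable_const _).add (hi1.const_mul _)) fun x => ?_
        exact abs_rpow_sub_sum_layer_le hq (norm_nonneg _) ((LInf.norm_apply_le f x).trans hf)
          (fun j => ‖g j x‖) (fun j => norm_nonneg _)
          fun j hj => (LInf.abs_norm_sub_norm_le f (g j) x).trans (hg j hj)
    _ = _ := by
        rw [integral_add (integrable_const _) (hi1.const_mul _), integral_const_mul]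
        simp

/-- The deterministic part: if the layers of the net functions are well discretized, then so is
every function of norm one. -/
theorem discretization_of_layers (μ : Measure Ω) [IsProbabilityMeasure μ] {q : ℝ}
    (hq : 1 ≤ q) {m J : ℕ} (hm : 0 < m) (x : Fin m → Ω) {ε : ℝ} (hε : J * ε ≤ 1 / 16)
    {f : LInf Ω} (hf : ‖f‖ ≤ 1 / 32 * 2 ^ J) (hf1 : ∫ y, ‖f y‖ ^ q ∂μ = 1) (g : ℕ → LInf Ω)
    (hg : ∀ j < J, dist f (g j) ≤ netRatio q * (1 / 32 * 2 ^ j))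
    (hgx : ∀ j < J, |1 / (m : ℝ) * ∑ i, layer q (1 / 32 * 2 ^ j) ‖g j (x i)‖ -
      ∫ y, layer q (1 / 32 * 2 ^ j) ‖g j y‖ ∂μ| ≤ ε) :
    3 / 4 ≤ 1 / (m : ℝ) * ∑ i, ‖f (x i)‖ ^ q ∧ 1 / (m : ℝ) * ∑ i, ‖f (x i)‖ ^ q ≤ 5 / 4 := by
  have hprob := isProbabilityMeasure_average hm fun i => Measure.dirac (x i)
  have h1 := abs_integral_rpow_sub_sum_layer_le μ hq hf g hg
  have h2 := abs_integral_rpow_sub_sum_layer_le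
    ((m : ℝ≥0∞)⁻¹ • ∑ i, Measure.dirac (x i)) hq hf g hg
  rw [integral_average_dirac x ((LInf.measurable f).norm.pow_const q)] at h2
  have hlay : ∀ j, ∫ y, layer q (1 / 32 * 2 ^ j) ‖g j y‖
        ∂((m : ℝ≥0∞)⁻¹ • ∑ i, Measure.dirac (x i)) =
      1 / (m : ℝ) * ∑ i, layer q (1 / 32 * 2 ^ j) ‖g j (x i)‖ := fun j =>
    integral_average_dirac x ((measurable_layer q _).comp (LInf.measurable (g j)).norm)
  simp_rw [hlay] at h2
  rw [hf1] at h1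
  have h3 : |∑ j ∈ Finset.range J, (1 / (m : ℝ) * ∑ i, layer q (1 / 32 * 2 ^ j) ‖g j (x i)‖) -
      ∑ j ∈ Finset.range J, ∫ y, layer q (1 / 32 * 2 ^ j) ‖g j y‖ ∂μ| ≤ 1 / 16 := by
    rw [← Finset.sum_sub_distrib]
    refine (Finset.abs_sum_le_sum_abs _ _).trans
      ((Finset.sum_le_sum fun j hj => hgx j (Finset.mem_range.1 hj)).trans ?_)
    simpa using hε
  -- If `A` is the empirical mean, the errors `1/16` for `μ`, `1/16` for the layers and `(1 + A)/32`
  -- for the sample give `27/33 ≤ A ≤ 37/31`.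
  rw [abs_le] at h1 h2 h3
  constructor <;> linarith [h1.1, h1.2, h2.1, h2.2, h3.1, h3.2]

/-- Bernstein's inequality with `M = (2 * a) ^ q`; the mean is at most `‖g‖_q ^ q ≤ 1`. The average
of the laws being `μ` identifies the mean with the integral over `μ`. -/
theorem measureReal_layer_deviation_le {μ : Measure Ω} [IsProbabilityMeasure μ] {q : ℝ}
    (hq : 1 ≤ q) {S : Type*} [MeasurableSpace S] {P : Measure S} [IsProbabilityMeasure P]
    {m : ℕ} (hm : 0 < m) {ξ : Fin m → S → Ω} (hξ : ∀ j, Measurable (ξ j)) (hind : iIndepFun ξ P)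
    (hμ : (m : ℝ≥0∞)⁻¹ • ∑ j, P.map (ξ j) = μ) {g : LInf Ω} (hg : lqNorm μ q g ≤ 1)
    {a ε : ℝ} (ha : 0 < a) (hε : 0 < ε) (hε1 : ε ≤ 1) :
    P.real {s | ε ≤ |1 / (m : ℝ) * ∑ j, layer q a ‖g (ξ j s)‖ - ∫ x, layer q a ‖g x‖ ∂μ|} ≤
      2 * Real.exp (-(m * ε ^ 2 / (4 * (2 * a) ^ q))) := by
  have hF : Measurable fun x => layer q a ‖g x‖ := (measurable_layer q a).comp (LInf.measurable g).norm
  have hprob : ∀ j, IsProbabilityMeasure (P.map (ξ j)) := fun j =>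
    Measure.isProbabilityMeasure_map (hξ j).aemeasurable
  refine measureReal_abs_average_sub_ge_le hm (Y := fun j s => layer q a ‖g (ξ j s)‖)
    (fun j => hF.comp (hξ j)) (hind.comp (fun _ x => layer q a ‖g x‖) fun _ => hF)
    (by positivity) (fun j s => layer_nonneg hq ha (norm_nonneg _))
    (fun j s => layer_le hq ha (norm_nonneg _)) ?_ ?_ hε hε1
  · conv_rhs => rw [← hμ]
    rw [integral_average _ fun j => LInf.integrable_layer _ hq ha g]
    congr 1
    exact Finset.sum_congr rfl fun j _ =>
      (integral_map (hξ j).aemeasurable hF.aestronglyMeasurable).symm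
  · calc ∫ x, layer q a ‖g x‖ ∂μ ≤ ∫ x, ‖g x‖ ^ q ∂μ :=
          integral_mono (LInf.integrable_layer μ hq ha g) (LInf.integrable_rpow μ (by linarith) g)
            fun x => layer_le_rpow hq ha (norm_nonneg _)
      _ = lqNorm μ q g ^ q := (lqNorm_rpow μ hq g).symm
      _ ≤ 1 := Real.rpow_le_one (lqNorm_nonneg _ _ _) hg (by linarith)

end

/-! ### Cardinality of the nets and the union bound over the levels -/

theorem sum_half_pow_sub_le (n : ℕ) :
    ∑ j ∈ Finset.range (n + 1), (1 / 2 : ℝ) ^ (n - j + 1) ≤ 1 := by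
  have h : ∀ k : ℕ, ∑ i ∈ Finset.range k, (1 / 2 : ℝ) ^ (i + 1) = 1 - (1 / 2) ^ k := fun k => by
    induction k with
    | zero => simp
    | succ k ih => rw [Finset.sum_range_succ, ih]; ring
  have h2 := Finset.sum_range_reflect (fun i => (1 / 2 : ℝ) ^ (i + 1)) (n + 1)
  simp only [Nat.add_sub_cancel] at h2
  rw [h2, h]
  have : (0 : ℝ) ≤ (1 / 2) ^ (n + 1) := by positivity
  linarith

theorem two_pow_le_exp {k : ℕ} {x : ℝ} (h : (k : ℝ) ≤ x) : (2 : ℝ) ^ k ≤ Real.exp x := by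
  have h1 : (2 : ℝ) ≤ Real.exp 1 := by linarith [Real.add_one_le_exp (1 : ℝ)]
  calc (2 : ℝ) ^ k ≤ Real.exp 1 ^ k := by gcongr
    _ = Real.exp k := Real.exp_one_pow k
    _ ≤ _ := Real.exp_le_exp.2 h

/-- The exponent of the cardinality of the net of radius `r`, where `B` is the scale of the
entropy numbers. -/
noncomputable def netExponent (q B r : ℝ) : ℕ := ⌊(B / r) ^ q⌋₊ + 1

/-- Half of the Bernstein exponent pays for the net; the other half is weakest at height `H` and
survives as the final bound. A surplus `exp (-κ)` at each level makes the sum over levels geometric,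
so the number of levels is not lost. -/
theorem sum_two_pow_netExponent_mul_exp_le {q B H ε m : ℝ} (hq : 1 ≤ q) (hB : 0 < B)
    (hHB : H ≤ 3 * B) {n : ℕ} (hn : 1 / 32 * 2 ^ n ≤ H)
    (hm : 32 * B ^ q * (2 / netRatio q) ^ q ≤ m * ε ^ 2) :
    ∑ j ∈ Finset.range (n + 1), 2 ^ netExponent q B (netRatio q * (1 / 32 * 2 ^ j)) *
        (2 * Real.exp (-(m * ε ^ 2 / (4 * (2 * (1 / 32 * 2 ^ j)) ^ q)))) ≤
      Real.exp (-(m * ε ^ 2 / (8 * (2 * H) ^ q))) := by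
  have hδ := netRatio_pos hq
  have hδ' := netRatio_le hq
  have hm0 : 0 ≤ m * ε ^ 2 := le_trans (by positivity) hm
  have hterm : ∀ j ∈ Finset.range (n + 1),
      2 ^ netExponent q B (netRatio q * (1 / 32 * 2 ^ j)) *
        (2 * Real.exp (-(m * ε ^ 2 / (4 * (2 * (1 / 32 * 2 ^ j)) ^ q)))) ≤
      (1 / 2 : ℝ) ^ (n - j + 1) * Real.exp (-(m * ε ^ 2 / (8 * (2 * H) ^ q))) := by
    intro j hj
    have hjn : j ≤ n := Nat.lt_succ_iff.1 (Finset.mem_range.1 hj)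
    set a : ℝ := 1 / 32 * 2 ^ j with ha
    have hapos : 0 < a := by positivity
    set κ : ℝ := (B / (netRatio q * a)) ^ q with hκ
    -- Entropy exponent times layer height does not depend on the level.
    have hκeq : κ * (2 * a) ^ q = B ^ q * (2 / netRatio q) ^ q := by
      rw [hκ, ← Real.mul_rpow (by positivity) (by positivity),
        ← Real.mul_rpow (by positivity) (by positivity)]
      congr 1
      field_simp
    have han : a * 2 ^ (n - j) ≤ H := by
      rw [ha, mul_assoc, ← pow_add, Nat.add_sub_cancel' hjn]
      exact hn
    have hpow1 : (1 : ℝ) ≤ 2 ^ (n - j) := one_le_pow₀ (by norm_num)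
    have haH : a ≤ H := le_trans (by nlinarith) han
    -- Here `H ≤ 3 * B` is needed: `netRatio q * a * 2 ^ (n - j) ≤ 3 * B / 64 ≤ B`.
    have hκge : ((n - j + 1 : ℕ) : ℝ) ≤ κ := by
      have h1 : (2 : ℝ) ^ (n - j) ≤ B / (netRatio q * a) := by
        rw [le_div_iff₀ (by positivity)]
        nlinarith
      have h2 : B / (netRatio q * a) ≤ κ := by
        rw [hκ]
        simpa using Real.rpow_le_rpow_of_exponent_le (hpow1.trans h1) hq
      have h3 : ((n - j + 1 : ℕ) : ℝ) ≤ 2 ^ (n - j) := by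
        exact_mod_cast Nat.lt_two_pow_self
      linarith
    have hκ1 : 1 ≤ κ := le_trans (by push_cast; linarith [Nat.cast_nonneg (α := ℝ) (n - j)]) hκge
    -- One `κ` for the floor, one for the `+ 1` in `netExponent`, one for the factor `2` of the two
    -- tails.
    have hcard : (2 : ℝ) ^ netExponent q B (netRatio q * a) * 2 ≤ Real.exp (3 * κ) := by
      rw [← pow_succ]
      refine two_pow_le_exp ?_
      have := Nat.floor_le (by linarith : 0 ≤ κ)
      rw [netExponent]
      push_cast
      linarith
    have hE1 : 4 * κ ≤ m * ε ^ 2 / (8 * (2 * a) ^ q) := by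
      rw [le_div_iff₀ (by positivity)]
      linarith
    have hE2 : m * ε ^ 2 / (8 * (2 * H) ^ q) ≤ m * ε ^ 2 / (8 * (2 * a) ^ q) := by
      gcongr
    have hE : m * ε ^ 2 / (4 * (2 * a) ^ q) =
        m * ε ^ 2 / (8 * (2 * a) ^ q) + m * ε ^ 2 / (8 * (2 * a) ^ q) := by
      field_simp
      ring
    have hhalf : Real.exp (-κ) ≤ (1 / 2 : ℝ) ^ (n - j + 1) := by
      rw [Real.exp_neg, one_div, inv_pow]
      exact inv_anti₀ (by positivity) (two_pow_le_exp hκge)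
    calc _ = (2 : ℝ) ^ netExponent q B (netRatio q * a) * 2 *
          Real.exp (-(m * ε ^ 2 / (4 * (2 * a) ^ q))) := by ring
      _ ≤ Real.exp (3 * κ) * Real.exp (-(4 * κ) + -(m * ε ^ 2 / (8 * (2 * H) ^ q))) := by
          gcongr
          linarith
      _ = Real.exp (-κ) * Real.exp (-(m * ε ^ 2 / (8 * (2 * H) ^ q))) := by
          rw [← Real.exp_add, ← Real.exp_add]
          ring_nf
      _ ≤ _ := by gcongr
  refine (Finset.sum_le_sum hterm).trans ?_
  rw [← Finset.sum_mul]
  exact mul_le_of_le_one_left (Real.exp_pos _).le (sum_half_pow_sub_le n)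

/-- Solving `B₁ * (v / k) ^ (1 / q) < r` for `k`; the `+ 1` after the floor makes the inequality
strict, so that the infimum yields an actual net. -/
theorem entropyNumber_netExponent_lt {X : Type*} [PseudoEMetricSpace X] {A : Set X}
    {q B₁ v : ℝ} (hq : 1 ≤ q) (hB₁ : 0 < B₁) (hv : 0 < v)
    (h : ∀ k : ℕ, 1 ≤ k → entropyNumber k A ≤ ENNReal.ofReal (B₁ * (v / k) ^ (1 / q)))
    {r : ℝ} (hr : 0 < r) :
    entropyNumber (netExponent q (B₁ * v ^ (1 / q)) r) A < ENNReal.ofReal r := by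
  set k := netExponent q (B₁ * v ^ (1 / q)) r with hk
  have hk1 : 1 ≤ k := by rw [hk, netExponent]; omega
  have hk0 : (0 : ℝ) < k := by exact_mod_cast hk1
  refine (h k hk1).trans_lt ((ENNReal.ofReal_lt_ofReal_iff hr).2 ?_)
  have hlt : (B₁ * v ^ (1 / q) / r) ^ q < k := by
    rw [hk, netExponent]
    push_cast
    exact Nat.lt_floor_add_one _
  have h1 : B₁ * v ^ (1 / q) / r < (k : ℝ) ^ (1 / q) := by
    have := Real.rpow_lt_rpow (by positivity) hlt (by positivity : 0 < 1 / q)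
    rwa [← Real.rpow_mul (by positivity), mul_one_div_cancel (by linarith), Real.rpow_one] at this
  rw [Real.div_rpow hv.le hk0.le, ← mul_div_assoc, div_lt_iff₀ (by positivity)]
  rw [div_lt_iff₀ hr] at h1
  linarith

/-! ### Passage from the nets to all sparse functions -/

section

variable {Ω : Type*} [MeasurableSpace Ω] {N : ℕ} {φ : Fin N → LInf Ω} {v : ℕ}

/-- The discretization theorem in terms of a bound `H` of the sparse ball in the supremum norm and
a precision `ε` for each dyadic layer. -/
theorem one_sub_exp_le_measureReal_discretization {μ : Measure Ω} [IsProbabilityMeasure μ]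
    {q : ℝ} (hq : 1 ≤ q) (hv : 1 ≤ v) {B₁ : ℝ} (hB₁ : 1 ≤ B₁)
    (hent : ∀ k : ℕ, 1 ≤ k → entropyNumber k (sparseBall μ q φ v) ≤
      ENNReal.ofReal (B₁ * ((v : ℝ) / (k : ℝ)) ^ (1 / q)))
    (hzero : ∀ f ∈ sparseSet φ v, lqNorm μ q f = 0 → f = 0)
    {H : ℝ} (hH3 : H ≤ 3 * (B₁ * (v : ℝ) ^ (1 / q)))
    (hH : ∀ f ∈ sparseBall μ q φ v, ‖f‖ ≤ H)
    {S : Type*} [MeasurableSpace S] {P : Measure S} [IsProbabilityMeasure P]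
    {m : ℕ} (hm : 0 < m) {ξ : Fin m → S → Ω} (hξ : ∀ j, Measurable (ξ j)) (hind : iIndepFun ξ P)
    (hμ : (m : ℝ≥0∞)⁻¹ • ∑ j, P.map (ξ j) = μ) {ε : ℝ} (hε : 0 < ε) (hε1 : ε ≤ 1)
    {n : ℕ} (hn : 2 ^ n ≤ 32 * H) (hn' : 32 * H ≤ 2 ^ (n + 1)) (hnε : (n + 1) * ε ≤ 1 / 16)
    (hmε : 32 * (B₁ * (v : ℝ) ^ (1 / q)) ^ q * (2 / netRatio q) ^ q ≤ m * ε ^ 2) :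
    1 - Real.exp (-(m * ε ^ 2 / (8 * (2 * H) ^ q))) ≤
      P.real {s : S | ∀ f ∈ sparseSet φ v,
        3 / 4 * lqNorm μ q f ^ q ≤ 1 / (m : ℝ) * ∑ j, ‖f (ξ j s)‖ ^ q ∧
          1 / (m : ℝ) * ∑ j, ‖f (ξ j s)‖ ^ q ≤ 5 / 4 * lqNorm μ q f ^ q} := by
  have hvpos : (0 : ℝ) < v := by exact_mod_cast hv
  set B : ℝ := B₁ * (v : ℝ) ^ (1 / q) with hB
  have hBpos : 0 < B := by positivity
  have hδ := netRatio_pos hq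
  have hnet : ∀ j : ℕ, ∃ T : Finset (LInf Ω), (T : Set (LInf Ω)) ⊆ sparseBall μ q φ v ∧
      T.card ≤ 2 ^ netExponent q B (netRatio q * (1 / 32 * 2 ^ j)) ∧
      ∀ f ∈ sparseBall μ q φ v, ∃ g ∈ T, dist f g ≤ netRatio q * (1 / 32 * 2 ^ j) := fun j =>
    exists_finset_net_of_entropyNumber_lt
      (entropyNumber_netExponent_lt hq (by linarith) hvpos hent (by positivity))
  choose T hTsub hTcard hTnet using hnet
  set bad : ℕ → LInf Ω → Set S := fun j g => {s | ε ≤ |1 / (m : ℝ) *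
    ∑ i, layer q (1 / 32 * 2 ^ j) ‖g (ξ i s)‖ - ∫ x, layer q (1 / 32 * 2 ^ j) ‖g x‖ ∂μ|} with hbad
  have hbadP : P.real (⋃ j ∈ Finset.range (n + 1), ⋃ g ∈ T j, bad j g) ≤
      Real.exp (-(m * ε ^ 2 / (8 * (2 * H) ^ q))) := by
    refine le_trans ?_ (sum_two_pow_netExponent_mul_exp_le hq hBpos hH3 (n := n) (by linarith) hmε)
    refine (measureReal_biUnion_finset_le _ _).trans (Finset.sum_le_sum fun j _ => ?_)
    refine (measureReal_biUnion_finset_le _ _).trans ?_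
    refine (Finset.sum_le_sum fun g hg => measureReal_layer_deviation_le hq hm hξ hind hμ
      (hTsub j hg).2 (by positivity) hε hε1).trans ?_
    rw [Finset.sum_const, nsmul_eq_mul]
    gcongr
    exact_mod_cast hTcard j
  set good : Set S := {s : S | ∀ f ∈ sparseSet φ v,
        3 / 4 * lqNorm μ q f ^ q ≤ 1 / (m : ℝ) * ∑ j, ‖f (ξ j s)‖ ^ q ∧
          1 / (m : ℝ) * ∑ j, ‖f (ξ j s)‖ ^ q ≤ 5 / 4 * lqNorm μ q f ^ q} with hgood
  have hcover : Set.univ ⊆ good ∪ ⋃ j ∈ Finset.range (n + 1), ⋃ g ∈ T j, bad j g := by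
    intro s _
    by_cases hs : s ∈ ⋃ j ∈ Finset.range (n + 1), ⋃ g ∈ T j, bad j g
    · exact Or.inr hs
    left
    have hs' : ∀ j < n + 1, ∀ g ∈ T j, |1 / (m : ℝ) *
        ∑ i, layer q (1 / 32 * 2 ^ j) ‖g (ξ i s)‖ -
          ∫ x, layer q (1 / 32 * 2 ^ j) ‖g x‖ ∂μ| ≤ ε := fun j hj g hg => by
      by_contra hcon
      refine hs (Set.mem_biUnion (Finset.mem_coe.2 (Finset.mem_range.2 hj))
        (Set.mem_biUnion (Finset.mem_coe.2 hg) ?_))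
      exact (not_le.1 hcon).le
    intro f hf
    set c := lqNorm μ q f with hc
    rcases eq_or_lt_of_le (lqNorm_nonneg μ q f) with h0 | hcpos
    · have hf0 := hzero f hf h0.symm
      have hx : ∀ x, f x = 0 := fun x => by rw [hf0]; rfl
      simp [hc, ← h0, hx, Real.zero_rpow (by linarith : q ≠ 0)]
    · set F : LInf Ω := ((c⁻¹ : ℝ) : ℂ) • f with hF
      have hnorm : ‖((c⁻¹ : ℝ) : ℂ)‖ = c⁻¹ := by
        rw [Complex.norm_real, Real.norm_of_nonneg (by positivity)]
      have hF1 : lqNorm μ q F = 1 := by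
        rw [hF, lqNorm_smul μ hq, hnorm, inv_mul_cancel₀ hcpos.ne']
      have hFmem : F ∈ sparseBall μ q φ v := ⟨smul_mem_sparseSet hf _, hF1.le⟩
      choose g hgT hg using fun j => hTnet j F hFmem
      have hFint : ∫ y, ‖F y‖ ^ q ∂μ = 1 := by rw [← lqNorm_rpow μ hq, hF1, Real.one_rpow]
      have key := discretization_of_layers μ hq hm (fun i => ξ i s) (J := n + 1)
        (by exact_mod_cast hnε) ((hH F hFmem).trans (by linarith)) hFint g (fun j _ => hg j)
        fun j hj => hs' j hj (g j) (hgT j)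
      have hFsum : 1 / (m : ℝ) * ∑ i, ‖F (ξ i s)‖ ^ q =
          (1 / (m : ℝ) * ∑ i, ‖f (ξ i s)‖ ^ q) / c ^ q := by
        have hFi : ∀ i, ‖F (ξ i s)‖ ^ q = ‖f (ξ i s)‖ ^ q / c ^ q := fun i => by
          rw [hF, LInf.norm_smul_apply, hnorm, Real.mul_rpow (inv_nonneg.2 hcpos.le)
            (norm_nonneg _), Real.inv_rpow hcpos.le, div_eq_inv_mul]
        rw [Finset.sum_congr rfl fun i _ => hFi i, ← Finset.sum_div, mul_div_assoc]
      rw [hFsum, le_div_iff₀ (by positivity), div_le_iff₀ (by positivity)] at key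
      exact key
  -- Monotonicity and subadditivity suffice, so the good event need not be measurable.
  have h1 : 1 ≤ P.real good + P.real (⋃ j ∈ Finset.range (n + 1), ⋃ g ∈ T j, bad j g) := by
    calc (1 : ℝ) = P.real Set.univ := by simp
      _ ≤ _ := measureReal_mono hcover
      _ ≤ _ := measureReal_union_le _ _
  linarith

end

end SparseDiscretization

/-! ### Choice of the constants, of `H` and of `ε` -/

theorem theorem2p1 (q : ℝ) (hq : 1 ≤ q) :
    ∃ C c : ℝ, 1 < C ∧ 0 < c ∧
      ∀ (Ω : Type*) [TopologicalSpace Ω] [T2Space Ω] [LocallyCompactSpace Ω]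
        [MeasurableSpace Ω] [BorelSpace Ω] (μ : Measure Ω) [IsProbabilityMeasure μ]
        (v N : ℕ) (_ : 1 ≤ v) (_ : v ≤ N) (φ : Fin N → SparseDiscretization.LInf Ω)
        (B₁ B₂ : ℝ) (_ : 1 ≤ B₁) (_ : 1 ≤ B₂)
        (_ : ∀ k : ℕ, 1 ≤ k →
          SparseDiscretization.entropyNumber k (SparseDiscretization.sparseBall μ q φ v) ≤
            ENNReal.ofReal (B₁ * ((v : ℝ) / (k : ℝ)) ^ (1 / q)))
        (_ : ∀ f ∈ SparseDiscretization.sparseSet φ v,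
          ‖f‖ ≤ B₂ * (v : ℝ) ^ (1 / q) * SparseDiscretization.lqNorm μ q f)
        (S : Type*) [MeasurableSpace S] (P : Measure S) [IsProbabilityMeasure P]
        (m : ℕ) (ξ : Fin m → S → Ω) (_ : ∀ j, Measurable (ξ j)) (_ : iIndepFun ξ P)
        (_ : (m : ℝ≥0∞)⁻¹ • ∑ j, P.map (ξ j) = μ)
        (_ : C * B₁ ^ q * (v : ℝ) * Real.log (2 * B₂ * (v : ℝ)) ^ 2 ≤ (m : ℝ)),
        1 - Real.exp (-(c * (m : ℝ) /
              (B₂ ^ q * (v : ℝ) * Real.log (2 * B₂ * (v : ℝ)) ^ 2))) ≤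
          P.real {s : S | ∀ f ∈ SparseDiscretization.sparseSet φ v,
            3 / 4 * SparseDiscretization.lqNorm μ q f ^ q ≤
                1 / (m : ℝ) * ∑ j, ‖f (ξ j s)‖ ^ q ∧
              1 / (m : ℝ) * ∑ j, ‖f (ξ j s)‖ ^ q ≤
                5 / 4 * SparseDiscretization.lqNorm μ q f ^ q} := by
  have hδ := SparseDiscretization.netRatio_pos hq
  have hδ' := SparseDiscretization.netRatio_le hq
  -- There are at most `9 * Λ` levels, and their deviations must sum to at most `1 / 16`: hence `ε =
  -- 1 / (144 * Λ)`.
  refine ⟨32 * 144 ^ 2 * (2 / SparseDiscretization.netRatio q) ^ q, 1 / (8 * 144 ^ 2 * 2 ^ q),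
    ?_, by positivity, ?_⟩
  · have h1 : (1 : ℝ) ≤ (2 / SparseDiscretization.netRatio q) ^ q :=
      Real.one_le_rpow (by rw [le_div_iff₀ hδ]; linarith) (by linarith)
    linarith
  intro Ω _ _ _ _ _ μ _ v N hv hvN φ B₁ B₂ hB₁ hB₂ hent hsup S _ P _ m ξ hξ hind hμ hm
  have hv1 : (1 : ℝ) ≤ v := by exact_mod_cast hv
  have hBv : 1 ≤ B₂ * (v : ℝ) := one_le_mul_of_one_le_of_one_le hB₂ hv1
  set Λ : ℝ := Real.log (2 * B₂ * (v : ℝ)) with hΛ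
  have hlog2 : Real.log 2 ≤ Λ := Real.log_le_log (by norm_num) (by linarith)
  have hΛpos : 2 / 3 < Λ := by linarith [Real.log_two_gt_d9]
  have hVq : ((v : ℝ) ^ (1 / q)) ^ q = v := by
    rw [← Real.rpow_mul (by positivity), one_div_mul_cancel (by linarith), Real.rpow_one]
  set V : ℝ := (v : ℝ) ^ (1 / q) with hV
  have hV1 : 1 ≤ V := Real.one_le_rpow hv1 (by positivity)
  have hVv : V ≤ v := by
    rw [← hVq]
    simpa using Real.rpow_le_rpow_of_exponent_le hV1 hq
  have hmpos : 0 < m := by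
    have h1 : (0 : ℝ) < 32 * 144 ^ 2 * (2 / SparseDiscretization.netRatio q) ^ q * B₁ ^ q * v *
        Λ ^ 2 := by positivity
    exact_mod_cast h1.trans_le hm
  -- The bound by `B₂` gives the final probability and the logarithm; the bound by `3 * B₁` is
  -- needed in the union bound and follows from the entropy number with `k = 1`.
  set H : ℝ := min B₂ (3 * B₁) * V with hH
  have hmin : 1 ≤ min B₂ (3 * B₁) := le_min hB₂ (by linarith)
  have hH1 : 1 ≤ H := one_le_mul_of_one_le_of_one_le hmin hV1
  have hHB₂ : H ≤ B₂ * V := mul_le_mul_of_nonneg_right (min_le_left _ _) (by linarith)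
  have hH3 : H ≤ 3 * (B₁ * V) := by
    rw [← mul_assoc]
    exact mul_le_mul_of_nonneg_right (min_le_right _ _) (by linarith)
  have hHsup : ∀ f ∈ SparseDiscretization.sparseBall μ q φ v, ‖f‖ ≤ H := fun f hf => by
    rw [hH, min_mul_of_nonneg _ _ (by linarith : 0 ≤ V)]
    refine le_min ?_ ?_
    · refine (hsup f hf.1).trans (mul_le_of_le_one_right (by positivity) hf.2)
    · have h1 := hent 1 le_rfl
      rw [Nat.cast_one, div_one] at h1
      have h2 := SparseDiscretization.norm_le_of_entropyNumber_one_lt (r := 3 / 2 * (B₁ * V)) hq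
        (h1.trans_lt ((ENNReal.ofReal_lt_ofReal_iff (by positivity)).2 (by
          have : 0 < B₁ * V := by positivity
          linarith))) hf
      linarith
  obtain ⟨n, hn, hn'⟩ := exists_nat_pow_near (by linarith : 1 ≤ 32 * H) (by norm_num : (1 : ℝ) < 2)
  have hnΛ : ((n : ℝ) + 1) ≤ 9 * Λ := by
    -- Taking logarithms, `n * log 2 ≤ 4 * log 2 + Λ`, so `(n + 1) * log 2 ≤ 6 * Λ`; then `log 2 > 2
    -- / 3` gives `9 * Λ`.
    have h1 : (2 : ℝ) ^ n ≤ 2 ^ 4 * (2 * B₂ * v) := by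
      have : B₂ * V ≤ B₂ * v := by gcongr
      linarith
    have h2 := Real.log_le_log (by positivity) h1
    rw [Real.log_mul (by norm_num) (by positivity), Real.log_pow, Real.log_pow, ← hΛ] at h2
    push_cast at h2
    have h3 : ((n : ℝ) + 1) * Real.log 2 ≤ 6 * Λ := by linarith
    have h4 := Real.log_two_gt_d9
    have h5 : ((n : ℝ) + 1) * (2 / 3) ≤ ((n : ℝ) + 1) * Real.log 2 := by gcongr; linarith
    linarith
  have hmain := SparseDiscretization.one_sub_exp_le_measureReal_discretization hq hv hB₁ hent
    (fun f hf h0 => by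
      have := hsup f hf
      rw [h0, mul_zero] at this
      exact norm_le_zero_iff.1 this)
    hH3 hHsup hmpos hξ hind hμ (ε := 1 / (144 * Λ)) (by positivity)
    (by rw [div_le_one (by positivity)]; linarith) hn hn'.le
    (by rw [mul_one_div, div_le_iff₀ (by positivity)]; linarith)
    (by
      rw [← hV, Real.mul_rpow (by positivity) (by positivity), hVq, div_pow, mul_pow, one_pow,
        mul_one_div, le_div_iff₀ (by positivity)]
      linarith)
  refine le_trans (sub_le_sub_left (Real.exp_le_exp.2 (neg_le_neg ?_)) 1) hmain
  have hHq : (2 * H) ^ q ≤ 2 ^ q * (B₂ ^ q * v) := by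
    rw [Real.mul_rpow (by norm_num) (by linarith)]
    have : H ^ q ≤ B₂ ^ q * v := by
      rw [← hVq, ← Real.mul_rpow (by positivity) (by positivity)]
      exact Real.rpow_le_rpow (by linarith) hHB₂ (by linarith)
    gcongr
  calc _ = m * (1 / (144 * Λ)) ^ 2 / (8 * (2 ^ q * (B₂ ^ q * v))) := by
        field_simp
    _ ≤ _ := by gcongr
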